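/- Let $p$ be a prime, $G$ a finite group, $\mathbb{F}$ a field of characteristic $p$ and $\mathbb{K}$ a field of characteristic $0$. Let $n$ be a positive integer divisible by the $p'$-part of the exponent of $G$ such that $\mathbb{F}$ and $\mathbb{K}$ both contain primitive $n$-th roots of unity, and fix an isomorphism $\theta$ from the group of $n$-th roots of unity of $\mathbb{F}$ to that of $\mathbb{K}$. For a subgroup $H$ write $\overline{N}_G(H)=N_G(H)/H$, and ${}^gx=gxg^{-1}$ for $g \in G$. For a section $H$ of $G$, the Brauer character of a finite-dimensional $\mathbb{F}H$-module $M$ is the $\mathbb{K}$-valued function on the $p'$-elements of $H$ (elements of order prime to $p$) whose value at $h$ is $\sum_\lambda \theta(\lambda)$, where $\lambda$ runs over the eigenvalues of $h$ on $M$ with multiplicity. For a $p$-subgroup $Q$ of $G$ and an $\mathbb{F}G$-module $M$, the Brauer quotient is the $\mathbb{F}\overline{N}_G(Q)$-module $$M[Q]=M^Q\Big/\sum_{P<Q}\mathrm{tr}_P^Q(M^P),\qquad \mathrm{tr}_P^Q(m)=\sum_{uP\subseteq Q}um .$$ For a $p'$-element $s$ of $\overline{N}_G(Q)$, let $\epsilon^G_{Q,s}[M]$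 be the value at $s$ of the Brauer character of $M[Q]$. For a $p$-subgroup $R$ of $G$ and an irreducible Brauer character $\psi$ of $\mathbb{F}\overline{N}_G(R)$ (the Brauer character of a simple module), let $E_\psi$ be the indecomposable projective $\mathbb{F}\overline{N}_G(R)$-module whose simple head $E_\psi/J(E_\psi)$ has Brauer character $\psi$, let $\widehat\psi$ be the Brauer character of $E_\psi$, and put $$N^G_{R,\psi}=\mathrm{Ind}_{N_G(R)}^G\,\mathrm{Inf}_{\overline{N}_G(R)}^{N_G(R)}(E_\psi),\qquad n_G(Q,s;R,\psi)=\epsilon^G_{Q,s}[N^G_{R,\psi}].$$ **Proposition 3.4.** Let $Q$ and $R$ be $p$-subgroups of $G$, let $s$ be a $p'$-element of $\overline{N}_G(Q)$, and let $\psi$ be an irreducible Brauer character of $\mathbb{F}\overline{N}_G(R)$. Write $s=tQ$ with $t\in N_G(Q)$. Then $$n_G(Q,s;R,\psi)=\sum_{g\in G\,:\;{}^gQ\le R,\ {}^gt\in N_G(R)}\frac{\widehat\psi({}^gt\cdot R)}{|N_G(R)|}.$$ -/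

import Mathlib

open scoped Pointwise MonoidAlgebra

noncomputable section

namespace TrivialSource

/-! ### Brauer characters -/

/-- A `p'`-element of a group: an element whose order is prime to `p`. -/
def IsPPrimeElement (p : ℕ) {H : Type*} [Group H] (x : H) : Prop :=
  p.Coprime (orderOf x)

section BrauerCharacter

variable {F K : Type*} [Field F] [Field K] {n : ℕ} [NeZero n]

open Classical in
/-- The fixed identification `θ` of the `n`-th roots of unity of `F` with those of `K`, regarded as
a function on `F` (with value `0` at the elements that are not `n`-th roots of unity). -/
def liftRoot (θ : rootsOfUnity n F ≃* rootsOfUnity n K) (x : F) : K :=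
  if h : x ^ n = 1 then ((θ (rootsOfUnity.mkOfPowEq x h) : Kˣ) : K) else 0

/-- The Brauer character of a finite-dimensional representation `ρ` over `F`. Its value at a
`p'`-element `h` is the sum, over the eigenvalues of `ρ h` taken with multiplicity, of their
lifts to `K`. (Only the values at `p'`-elements are meaningful.) -/
def brauerChar (θ : rootsOfUnity n F ≃* rootsOfUnity n K) {H V : Type*} [Group H]
    [AddCommGroup V] [Module F V] [FiniteDimensional F V] (ρ : Representation F H V) (h : H) : K :=
  ((ρ h).charpoly.roots.map (liftRoot θ)).sum

end BrauerCharacter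

/-! ### Indecomposable projective modules and their heads -/

section Projective

variable {F H V : Type*} [Field F] [Group H] [AddCommGroup V] [Module F V]

/-- A module is indecomposable if it is non-zero and is not the direct sum of two non-zero
submodules. -/
def IsIndecomposable (A M : Type*) [Ring A] [AddCommGroup M] [Module A M] : Prop :=
  Nontrivial M ∧ ∀ X Y : Submodule A M, IsCompl X Y → X = ⊥ ∨ Y = ⊥

/-- The radical `J(V)`: the intersection of the maximal `F[H]`-submodules of `V`. -/
def radical (ρ : Representation F H V) : Submodule F V :=
  ((Module.jacobson F[H] ρ.asModule).restrictScalars F).map ρ.asModuleEquiv.toLinearMap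

theorem radical_le_comap (ρ : Representation F H V) (h : H) :
    radical ρ ≤ (radical ρ).comap (ρ h) := by
  rintro _ ⟨x, hx, rfl⟩
  refine ⟨MonoidAlgebra.of F H h • x,
    Submodule.smul_mem (Module.jacobson F[H] ρ.asModule) (MonoidAlgebra.of F H h) hx, ?_⟩
  simp
  rfl

/-- The head `V / J(V)`. -/
def head (ρ : Representation F H V) : Representation F H (V ⧸ radical ρ) :=
  ρ.quotient (radical ρ) (radical_le_comap ρ)

/-- `ρ` is the indecomposable projective module `E_ψ`: it is projective and indecomposable, and its
head is a simple module with Brauer character `ψ`, a `K`-valued function on the `p'`-elements. -/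
structure IsProjectiveIndecomposable (p : ℕ) {K : Type*} [Field K] {n : ℕ} [NeZero n]
    (θ : rootsOfUnity n F ≃* rootsOfUnity n K) (ψ : {x : H // IsPPrimeElement p x} → K)
    [FiniteDimensional F V] (ρ : Representation F H V) : Prop where
  projective : Module.Projective F[H] ρ.asModule
  indecomposable : IsIndecomposable F[H] ρ.asModule
  head_irreducible : (head ρ).IsIrreducible
  head_brauerChar : ∀ x, brauerChar θ (head ρ) x.1 = ψ x

end Projective

/-! ### The Brauer quotient -/

section BrauerQuotient

variable {F G V : Type*} [Field F] [Group G] [AddCommGroup V] [Module F V]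

/-- `N̄_G(P) = N_G(P) / P`. -/
abbrev NBar (P : Subgroup G) : Type _ :=
  Subgroup.normalizer (P : Set G) ⧸ P.subgroupOf (Subgroup.normalizer (P : Set G))

/-- The subspace `V^P` of `P`-fixed elements. -/
abbrev fixed (ρ : Representation F G V) (P : Subgroup G) : Submodule F V :=
  Representation.invariants (ρ.comp P.subtype)

theorem mem_fixed {ρ : Representation F G V} {P : Subgroup G} {v : V} :
    v ∈ fixed ρ P ↔ ∀ x ∈ P, ρ x v = v := by
  simp [fixed, Representation.mem_invariants]

/-- The term `ᵘm` of the relative trace attached to a coset `uQ ⊆ P` and `m ∈ V^Q`. -/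
def cosetAct (ρ : Representation F G V) (Q P : Subgroup G) (c : P ⧸ Q.subgroupOf P) :
    fixed ρ Q →ₗ[F] V :=
  ρ (c.out : G) ∘ₗ (fixed ρ Q).subtype

theorem cosetAct_mk (ρ : Representation F G V) (Q P : Subgroup G) (u : P) (m : fixed ρ Q) :
    cosetAct ρ Q P (QuotientGroup.mk u) m = ρ (u : G) (m : V) := by
  obtain ⟨q, hq⟩ := QuotientGroup.mk_out_eq_mul (Q.subgroupOf P) u
  have h1 : (((QuotientGroup.mk u : P ⧸ Q.subgroupOf P).out : P) : G) = u * ((q : P) : G) := by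
    rw [hq]; rfl
  have h2 : ρ ((q : P) : G) (m : V) = m := mem_fixed.1 m.2 _ q.2
  simp only [cosetAct, LinearMap.comp_apply, Submodule.subtype_apply, h1, map_mul,
    Module.End.mul_apply, h2]

/-- Conjugation by an element of `N_G(P)`, as a permutation of `P`. -/
def conjEquiv (P : Subgroup G) (x : Subgroup.normalizer (P : Set G)) : P ≃ P where
  toFun u := ⟨x * u * (x : G)⁻¹, (Subgroup.mem_normalizer_iff.1 x.2 u).1 u.2⟩
  invFun u := ⟨(x : G)⁻¹ * u * x, (Subgroup.mem_normalizer_iff''.1 x.2 u).1 u.2⟩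
  left_inv u := by ext; simp [mul_assoc]
  right_inv u := by ext; simp [mul_assoc]

theorem conj_mem_fixed (ρ : Representation F G V) (Q : Subgroup G) (x : G) (m : fixed ρ Q) :
    ρ x m ∈ fixed ρ (MulAut.conj x • Q) := by
  rw [mem_fixed]
  rintro _ ⟨y, hy, rfl⟩
  have h2 := mem_fixed.1 m.2 y hy
  change ρ (x * y * x⁻¹) (ρ x (m : V)) = _
  conv_rhs => rw [← h2]
  rw [← Module.End.mul_apply, ← Module.End.mul_apply, ← map_mul, ← map_mul]
  congr 2
  group

theorem fixed_le_comap (ρ : Representation F G V) (P : Subgroup G)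
    (x : Subgroup.normalizer (P : Set G)) :
    fixed ρ P ≤ (fixed ρ P).comap ((ρ.comp (Subgroup.normalizer (P : Set G)).subtype) x) := by
  intro v hv
  rw [Submodule.mem_comap, mem_fixed]
  intro y hy
  have h1 : (x : G)⁻¹ * y * x ∈ P := (Subgroup.mem_normalizer_iff''.1 x.2 y).1 hy
  have h2 := mem_fixed.1 hv _ h1
  change ρ y (ρ (x : G) v) = ρ (x : G) v
  conv_rhs => rw [← h2]
  rw [← Module.End.mul_apply, ← Module.End.mul_apply, ← map_mul, ← map_mul]
  congr 2
  group

/-- The action of `N_G(P)` on `V^P`. -/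
def fixedRep (ρ : Representation F G V) (P : Subgroup G) :
    Representation F (Subgroup.normalizer (P : Set G)) (fixed ρ P) :=
  Representation.subrepresentation (ρ.comp (Subgroup.normalizer (P : Set G)).subtype) (fixed ρ P)
    (fixed_le_comap ρ P)

variable [Finite G]

instance cosetFintype (Q P : Subgroup G) : Fintype (P ⧸ Q.subgroupOf P) := Fintype.ofFinite _

theorem relTrace_mem (ρ : Representation F G V) (Q P : Subgroup G) (m : fixed ρ Q) :
    (∑ c : P ⧸ Q.subgroupOf P, cosetAct ρ Q P c) m ∈ fixed ρ P := by
  rw [mem_fixed]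
  intro x hx
  simp only [LinearMap.sum_apply, map_sum]
  refine Fintype.sum_equiv (MulAction.toPerm (⟨x, hx⟩ : P)) _ _ fun c => ?_
  induction c using QuotientGroup.induction_on with
  | H u =>
    change _ = cosetAct ρ Q P (QuotientGroup.mk ((⟨x, hx⟩ : P) * u)) m
    rw [cosetAct_mk, cosetAct_mk]
    simp

/-- The relative trace map `tr_Q^P : V^Q → V^P`, sending `m` to the sum of the `ᵘm` over the
cosets `uQ ⊆ P`. -/
def relTrace (ρ : Representation F G V) (Q P : Subgroup G) : fixed ρ Q →ₗ[F] fixed ρ P :=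
  (∑ c : P ⧸ Q.subgroupOf P, cosetAct ρ Q P c).codRestrict _ (relTrace_mem ρ Q P)

/-- The sum, over the proper subgroups `Q < P`, of the images of the maps `tr_Q^P`. -/
def traceSum (ρ : Representation F G V) (P : Subgroup G) : Submodule F (fixed ρ P) :=
  ⨆ (Q : Subgroup G) (_ : Q < P), LinearMap.range (relTrace ρ Q P)

theorem traceSum_le_comap (ρ : Representation F G V) (P : Subgroup G)
    (x : Subgroup.normalizer (P : Set G)) :
    traceSum ρ P ≤ (traceSum ρ P).comap (fixedRep ρ P x) := by
  refine iSup₂_le fun Q hQ => ?_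
  rintro _ ⟨m, rfl⟩
  have hP : MulAut.conj (x : G) • P = P := Subgroup.mem_normalizer_iff_map_conj_eq.1 x.2
  have hlt : MulAut.conj (x : G) • Q < P := by
    refine lt_of_le_of_ne ?_ ?_
    · calc MulAut.conj (x : G) • Q ≤ MulAut.conj (x : G) • P :=
          Subgroup.pointwise_smul_le_pointwise_smul_iff.2 hQ.le
        _ = P := hP
    · intro h
      exact hQ.ne (smul_left_cancel _ (h.trans hP.symm))
  have key : fixedRep ρ P x (relTrace ρ Q P m) =
      relTrace ρ (MulAut.conj (x : G) • Q) P ⟨ρ x m, conj_mem_fixed ρ Q x m⟩ := by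
    apply Subtype.ext
    change ρ x ((∑ c : P ⧸ Q.subgroupOf P, cosetAct ρ Q P c) m) =
      (∑ c : P ⧸ (MulAut.conj (x : G) • Q).subgroupOf P, cosetAct ρ _ P c) _
    simp only [LinearMap.sum_apply, map_sum]
    let e : P ⧸ Q.subgroupOf P ≃ P ⧸ (MulAut.conj (x : G) • Q).subgroupOf P :=
      Quotient.congr (conjEquiv P x) ?_
    · refine Fintype.sum_equiv e _ _ fun c => ?_
      induction c using QuotientGroup.induction_on with
      | H u =>
        change _ = cosetAct ρ _ P (QuotientGroup.mk (conjEquiv P x u)) _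
        rw [cosetAct_mk, cosetAct_mk]
        simp [conjEquiv, ← Module.End.mul_apply, ← map_mul]
    · intro u v
      rw [QuotientGroup.leftRel_apply, QuotientGroup.leftRel_apply, Subgroup.mem_subgroupOf,
        Subgroup.mem_subgroupOf, Subgroup.mem_pointwise_smul_iff_inv_smul_mem]
      simp [conjEquiv, mul_assoc]
  rw [Submodule.mem_comap, key]
  exact le_iSup₂_of_le (f := fun (Q : Subgroup G) (_ : Q < P) => LinearMap.range (relTrace ρ Q P))
    _ hlt le_rfl ⟨_, rfl⟩

/-- The `F[N_G(P)]`-module `V^P / ∑_{Q < P} tr_Q^P(V^Q)`. -/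
def brauerQuotientAux (ρ : Representation F G V) (P : Subgroup G) :
    Representation F (Subgroup.normalizer (P : Set G)) (fixed ρ P ⧸ traceSum ρ P) :=
  (fixedRep ρ P).quotient (traceSum ρ P) (traceSum_le_comap ρ P)

instance brauerQuotientAux_isTrivial (ρ : Representation F G V) (P : Subgroup G) :
    Representation.IsTrivial ((brauerQuotientAux ρ P).comp
      (P.subgroupOf (Subgroup.normalizer (P : Set G))).subtype) where
  out := by
    intro y
    ext v
    change Submodule.Quotient.mk (fixedRep ρ P (y : Subgroup.normalizer (P : Set G)) v) =
      Submodule.Quotient.mk v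
    congr 1
    exact Subtype.ext (mem_fixed.1 v.2 _ y.2)

/-- The Brauer quotient `V[P] = V^P / ∑_{Q < P} tr_Q^P(V^Q)`, as an `F[N̄_G(P)]`-module. -/
def brauerQuotient (ρ : Representation F G V) (P : Subgroup G) :
    Representation F (NBar P) (fixed ρ P ⧸ traceSum ρ P) :=
  Representation.ofQuotient (brauerQuotientAux ρ P) _

end BrauerQuotient

/-! ### The table of marks -/

section Table

variable {F K G : Type*} [Field F] [Field K] [Group G] [Finite G] {n : ℕ} [NeZero n]

/-- The species `ε_{Q,s}^G`: the value at `s` of the Brauer character of `V[Q]`. -/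
def eps (θ : rootsOfUnity n F ≃* rootsOfUnity n K) (Q : Subgroup G) (s : NBar Q)
    {V : Type*} [AddCommGroup V] [Module F V] [FiniteDimensional F V]
    (ρ : Representation F G V) : K :=
  brauerChar θ (brauerQuotient ρ Q) s

/-- The `F[G]`-module `Ind_{N_G(R)}^G Inf_{N̄_G(R)}^{N_G(R)} (E)`, for an `F[N̄_G(R)]`-module `E`. -/
def indInf (R : Subgroup G) {E : Type*} [AddCommGroup E] [Module F E]
    (σ : Representation F (NBar R) E) :
    Representation F G (Representation.IndV (Subgroup.normalizer (R : Set G)).subtype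
      (σ.comp (QuotientGroup.mk' _))) :=
  Representation.ind (Subgroup.normalizer (R : Set G)).subtype (σ.comp (QuotientGroup.mk' _))

instance indInf_finite (R : Subgroup G) {E : Type*} [AddCommGroup E] [Module F E]
    [FiniteDimensional F E] (σ : Representation F (NBar R) E) :
    FiniteDimensional F (Representation.IndV (Subgroup.normalizer (R : Set G)).subtype
      (σ.comp (QuotientGroup.mk' _))) := by
  have : Module.Finite F (MonoidAlgebra F G) := inferInstance
  infer_instance

/-- The entry `n_G(Q, s; R, ψ) = ε_{Q,s}^G [N_{R,ψ}^G]`, where `σ` is the module `E_ψ` and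
`N_{R,ψ}^G = Ind Inf (E_ψ)`. -/
def tableEntry (θ : rootsOfUnity n F ≃* rootsOfUnity n K) (Q : Subgroup G) (s : NBar Q)
    (R : Subgroup G) {E : Type*} [AddCommGroup E] [Module F E] [FiniteDimensional F E]
    (σ : Representation F (NBar R) E) : K :=
  eps θ Q s (indInf R σ)

end Table

end TrivialSource

end

/-! Write N for N_G(R). The induced module is the space of functions f : G → E with f(xh) = x f(h)
for x in N, on which G acts by right translation; `indEval` reads off the values. Let f be fixed by
Q. If ʰQ ≤ R, then f(h) is not constrained by Q, and every trace from a proper subgroup P < Q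
vanishes at h: it multiplies the value at h by [Q : P], which is 0 in F. If ʰQ is not contained in
R, projectivity of E makes f(h) a trace from the trivial group, so a relative trace from Q ∩ Rʰ < Q
agrees with f on NhQ and can be subtracted. Hence the Brauer quotient is the space of families in E
indexed by the cosets gN with Q ≤ ᵍR (`ker_evalFixedCosets`, `brauerQuotientEquiv`). On these
families t permutes the coordinates up to automorphisms of E. A nontrivial cycle of cosets
contributes 0 to the Brauer character, because its eigenvalues are stable under multiplication by a
root of unity z ≠ 1 (`liftedRootSum_pi`). A fixed coset contributes the character of E at the
corresponding conjugate of t. Replacing the sum over cosets by a sum over G introduces the factor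
1/|N|. -/

noncomputable section

namespace TrivialSource

/-! ### Lifted traces of monomial block matrices -/

section LiftedTrace

variable {F K : Type*} [Field F] [Field K] {n : ℕ} [NeZero n]

/-- The sum of the lifts of the roots of a polynomial. -/
def liftedRootSum (θ : rootsOfUnity n F ≃* rootsOfUnity n K) (P : Polynomial F) : K :=
  (P.roots.map (liftRoot θ)).sum

theorem liftedRootSum_prod (θ : rootsOfUnity n F ≃* rootsOfUnity n K) {ι : Type*} (s : Finset ι)
    (P : ι → Polynomial F) (hP : ∀ i ∈ s, P i ≠ 0) :
    liftedRootSum θ (∏ i ∈ s, P i) = ∑ i ∈ s, liftedRootSum θ (P i) := by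
  unfold liftedRootSum
  rw [Polynomial.roots_prod _ _ (Finset.prod_ne_zero_iff.2 hP), Multiset.map_bind,
    Multiset.sum_bind]
  rfl

/-- Multiplication by `z` preserves both the `n`-th roots of unity and their complement, so the
value 0 off the roots of unity does no harm and `x` may be arbitrary. -/
theorem liftRoot_mul (θ : rootsOfUnity n F ≃* rootsOfUnity n K) {z : F} (hz : z ^ n = 1) (x : F) :
    liftRoot θ (z * x) = liftRoot θ z * liftRoot θ x := by
  unfold liftRoot
  by_cases hx : x ^ n = 1
  · have hzx : (z * x) ^ n = 1 := by rw [mul_pow, hz, hx, one_mul]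
    rw [dif_pos hzx, dif_pos hz, dif_pos hx]
    have : rootsOfUnity.mkOfPowEq (z * x) hzx =
        rootsOfUnity.mkOfPowEq z hz * rootsOfUnity.mkOfPowEq x hx := by
      ext; simp
    rw [this, map_mul]
    simp
  · have hzx : ¬ (z * x) ^ n = 1 := by rwa [mul_pow, hz, one_mul]
    rw [dif_neg hzx, dif_neg hx, mul_zero]

theorem liftRoot_ne_one (θ : rootsOfUnity n F ≃* rootsOfUnity n K) {z : F} (hz : z ^ n = 1)
    (hz1 : z ≠ 1) : liftRoot θ z ≠ 1 := by
  unfold liftRoot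
  rw [dif_pos hz]
  intro h
  have h1 : θ (rootsOfUnity.mkOfPowEq z hz) = 1 := by
    ext; simpa using h
  rw [map_eq_one_iff _ θ.injective] at h1
  apply hz1
  have := congrArg (fun x : rootsOfUnity n F => ((x : Fˣ) : F)) h1
  simpa using this

/-- Take determinants in zX - zN = z(X - N). -/
theorem charpoly_smul_comp {m : Type*} [Fintype m] [DecidableEq m] (z : F) (N : Matrix m m F) :
    (z • N).charpoly.comp (Polynomial.C z * Polynomial.X) =
      Polynomial.C z ^ Fintype.card m * N.charpoly := by
  rw [Matrix.charpoly, Matrix.charpoly, ← Matrix.det_smul, ← Polynomial.coe_compRingHom_apply,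
    RingHom.map_det]
  congr 1
  ext1 i j
  by_cases h : i = j
  · subst h
    simp [mul_sub]
  · simp [h]

/-- If conjugation by an invertible diagonal matrix multiplies `N` by a nontrivial root of unity,
then the lifts of the eigenvalues of `N` sum to zero. -/
theorem liftedRootSum_charpoly_eq_zero (θ : rootsOfUnity n F ≃* rootsOfUnity n K)
    {m : Type*} [Fintype m] [DecidableEq m] (N : Matrix m m F) (f : m → F) (hf : ∀ i, f i ≠ 0)
    {z : F} (hz : z ^ n = 1) (hz1 : z ≠ 1) (h : ∀ i j, N i j ≠ 0 → f j = z * f i) :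
    liftedRootSum θ N.charpoly = 0 := by
  have hz0 : z ≠ 0 := by
    rintro rfl
    rw [zero_pow (NeZero.ne n)] at hz
    exact zero_ne_one hz
  have hu : IsUnit (Matrix.diagonal f) := by
    rw [Matrix.isUnit_diagonal, Pi.isUnit_iff]
    exact fun i => (hf i).isUnit
  have hconj : (z • N).charpoly = N.charpoly := by
    obtain ⟨U, hU⟩ := hu
    rw [← Matrix.charpoly_units_conj' U N]
    congr 1
    -- With D the diagonal matrix of `f`, this says D⁻¹ N D = zN, so N and zN have the same
    -- characteristic polynomial.
    have h1 : N * Matrix.diagonal f = Matrix.diagonal f * (z • N) := by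
      ext i j
      rw [Matrix.mul_diagonal, Matrix.diagonal_mul]
      by_cases h0 : N i j = 0
      · simp [h0]
      · rw [h i j h0]
        simp only [Matrix.smul_apply, smul_eq_mul]
        ring
    rw [mul_assoc, hU, h1, ← hU, ← mul_assoc]
    simp
  have h2 := charpoly_smul_comp z N
  rw [hconj] at h2
  -- The multiset of roots is stable under multiplication by `z`; its lifted sum is therefore
  -- multiplied by the lift of `z`, which is not 1.
  have h3 : N.charpoly.roots.map (fun x => z * x) = N.charpoly.roots := by
    have h4 := Polynomial.map_roots_comp_C_mul_X_add_C N.charpoly z 0 hz0.isUnit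
    rw [Polynomial.C_0, add_zero, h2, ← Polynomial.C_pow,
      Polynomial.roots_C_mul _ (pow_ne_zero _ hz0)] at h4
    simpa using h4
  have h5 : liftedRootSum θ N.charpoly = liftRoot θ z * liftedRootSum θ N.charpoly := by
    unfold liftedRootSum
    conv_lhs => rw [← h3, Multiset.map_map]
    simp only [Function.comp_def, liftRoot_mul θ hz]
    rw [Multiset.sum_map_mul_left]
  have h6 : (1 - liftRoot θ z) * liftedRootSum θ N.charpoly = 0 := by
    rw [sub_mul, one_mul, ← h5, sub_self]
  exact (mul_eq_zero.1 h6).resolve_left (sub_ne_zero.2 (liftRoot_ne_one θ hz hz1).symm)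

/-- A function on a nontrivial cycle of `τ` that `τ` multiplies by a nontrivial root of unity. -/
theorem exists_cycle_eigenfunction [HasEnoughRootsOfUnity F n] {C : Type*} (τ : Equiv.Perm C)
    {k : ℕ} (hk : τ ^ k = 1) (hkn : k ∣ n) (c₀ : C) (hc₀ : τ c₀ ≠ c₀) :
    ∃ (z : F) (f : C → F), z ^ n = 1 ∧ z ≠ 1 ∧ (∀ c, f c ≠ 0) ∧
      ∀ c, τ.SameCycle c₀ c → f (τ c) = z * f c := by
  classical
  set m := Function.minimalPeriod (fun c => τ • c) c₀ with hm
  have hmk : m ∣ k := by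
    apply Function.IsPeriodicPt.minimalPeriod_dvd
    change ((fun c => τ c)^[k]) c₀ = c₀
    have : (τ ^ k) c₀ = c₀ := by rw [hk]; rfl
    rwa [Equiv.Perm.coe_pow] at this
  have := HasEnoughRootsOfUnity.of_dvd F (hmk.trans hkn)
  obtain ⟨z, hz⟩ := HasEnoughRootsOfUnity.exists_primitiveRoot F m
  have hm1 : m ≠ 1 := by
    intro h
    rw [hm, Function.minimalPeriod_eq_one_iff_isFixedPt] at h
    exact hc₀ h
  have hm0 : m ≠ 0 := by
    intro h
    have := hmk.trans hkn
    rw [h, zero_dvd_iff] at this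
    exact NeZero.ne n this
  have hz0 : z ≠ 0 := hz.ne_zero hm0
  -- The function is zⁱ at τⁱ c₀, well defined because `z` has order exactly the cycle length `m`.
  -- The value 1 off the cycle only keeps it nonzero.
  refine ⟨z, fun c => if h : ∃ i : ℤ, (τ ^ i) c₀ = c then z ^ h.choose else 1,
    (hz.pow_eq_one_iff_dvd n).2 (hmk.trans hkn), ?_, ?_, ?_⟩
  · intro h
    rw [h] at hz
    exact hm1 (hz.unique IsPrimitiveRoot.one)
  · intro c
    dsimp only
    split_ifs
    · exact zpow_ne_zero _ hz0
    · exact one_ne_zero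
  · intro c h
    have h' : τ.SameCycle c₀ (τ c) := Equiv.Perm.sameCycle_apply_right.2 h
    change ∃ i : ℤ, _ at h h'
    dsimp only
    rw [dif_pos h, dif_pos h', ← zpow_one_add₀ hz0]
    have e1 := h.choose_spec
    have e2 := h'.choose_spec
    generalize h.choose = i at *
    generalize h'.choose = j at *
    have key : (m : ℤ) ∣ j - (1 + i) := by
      rw [hm, ← MulAction.zpow_smul_eq_iff_minimalPeriod_dvd, Equiv.Perm.smul_def, sub_eq_neg_add,
        zpow_add, Equiv.Perm.mul_apply, e2, ← e1, zpow_neg, Equiv.Perm.inv_eq_iff_eq, zpow_add,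
        zpow_one]
      rfl
    rw [← div_eq_one_iff_eq (zpow_ne_zero _ hz0), ← zpow_sub₀ hz0, hz.zpow_eq_one_iff_dvd]
    exact key

open Classical in
/-- The lifted trace of a monomial block matrix only sees the blocks fixed by the permutation. -/
theorem liftedRootSum_monomial [HasEnoughRootsOfUnity F n]
    (θ : rootsOfUnity n F ≃* rootsOfUnity n K) {C ι : Type*} [Fintype C] [Fintype ι]
    (τ : Equiv.Perm C) {k : ℕ} (hk : τ ^ k = 1) (hkn : k ∣ n) (A : C → Matrix ι ι F) :
    liftedRootSum θ (Matrix.charpoly (Matrix.of fun (x y : C × ι) =>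
        if y.1 = τ x.1 then A x.1 x.2 y.2 else 0)) =
      ∑ c with τ c = c, liftedRootSum θ (A c).charpoly := by
  set M : Matrix (C × ι) (C × ι) F := Matrix.of fun (x y : C × ι) =>
    if y.1 = τ x.1 then A x.1 x.2 y.2 else 0 with hM
  have hMapply : ∀ x y, M x y = if y.1 = τ x.1 then A x.1 x.2 y.2 else 0 := fun _ _ => rfl
  let S := Equiv.Perm.SameCycle.setoid τ
  -- Cycles are numbered in `Fin` to give the blocks a linear order; no entry of `M` joins two
  -- different cycles.
  let o : C → Fin (Fintype.card (Quotient S)) := fun c => Fintype.equivFin _ (Quotient.mk S c)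
  have ho : ∀ c d, o c = o d ↔ τ.SameCycle c d := fun c d => by
    simp only [o, EmbeddingLike.apply_eq_iff_eq]
    exact Quotient.eq
  have hτo : ∀ c, o (τ c) = o c := fun c =>
    (ho _ _).2 (Equiv.Perm.sameCycle_apply_left.2 (Equiv.Perm.SameCycle.refl _ _))
  have htri : M.BlockTriangular (fun x => o x.1) := by
    intro x y hxy
    rw [hMapply, if_neg]
    intro h
    simp only [h, hτo, lt_self_iff_false] at hxy
  rw [htri.charpoly, liftedRootSum_prod _ _ _ fun _ _ => (Matrix.charpoly_monic _).ne_zero]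
  have hblock : ∀ a, liftedRootSum θ (M.toSquareBlock (fun x => o x.1) a).charpoly =
      ∑ c with τ c = c ∧ o c = a, liftedRootSum θ (A c).charpoly := by
    intro a
    by_cases hfix : ∃ c, τ c = c ∧ o c = a
    · obtain ⟨c, hc, rfl⟩ := hfix
      have huniq : ∀ d, o d = o c → d = c := by
        intro d hd
        obtain ⟨i, hi⟩ := (ho _ _).1 hd.symm
        rw [← hi]
        exact Equiv.Perm.zpow_apply_eq_self_of_apply_eq_self hc i
      have hs : (Finset.univ.filter fun d => τ d = d ∧ o d = o c) = {c} := by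
        ext d
        simp only [Finset.mem_filter, Finset.mem_univ, true_and, Finset.mem_singleton]
        exact ⟨fun h => huniq d h.2, fun h => by rw [h]; exact ⟨hc, rfl⟩⟩
      rw [hs, Finset.sum_singleton]
      let e : {x : C × ι // o x.1 = o c} ≃ ι :=
        { toFun := fun x => x.1.2
          invFun := fun i => ⟨(c, i), rfl⟩
          left_inv := fun x => Subtype.ext (Prod.ext (huniq _ x.2).symm rfl)
          right_inv := fun i => rfl }
      rw [← Matrix.charpoly_reindex e]
      congr 2
      ext i j
      change M (c, i) (c, j) = A c i j
      rw [hMapply, if_pos hc.symm]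
    · have hs : (Finset.univ.filter fun d => τ d = d ∧ o d = a) = ∅ := by
        ext d
        simp only [Finset.mem_filter, Finset.mem_univ, true_and, Finset.notMem_empty, iff_false]
        exact fun h => hfix ⟨d, h⟩
      rw [hs, Finset.sum_empty]
      by_cases hne : ∃ c₀, o c₀ = a
      · obtain ⟨c₀, rfl⟩ := hne
        obtain ⟨z, f, hz, hz1, hf, hfτ⟩ := exists_cycle_eigenfunction (F := F) τ hk hkn c₀
          fun h => hfix ⟨c₀, h, rfl⟩
        refine liftedRootSum_charpoly_eq_zero θ _ (fun x => f x.1.1) (fun x => hf _) hz hz1 ?_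
        intro x y hxy
        have h1 : M x.1 y.1 ≠ 0 := hxy
        rw [hMapply] at h1
        have h2 : y.1.1 = τ x.1.1 := by
          by_contra h
          exact h1 (if_neg h)
        rw [h2]
        exact hfτ _ ((ho _ _).1 x.2.symm)
      · have : IsEmpty {x : C × ι // o x.1 = a} := ⟨fun x => hne ⟨_, x.2⟩⟩
        have h1 : (M.toSquareBlock (fun x => o x.1) a).charpoly = 1 :=
          Matrix.det_isEmpty
        rw [h1]
        simp [liftedRootSum]
  simp only [hblock, Finset.sum_filter]
  -- The block product runs only over labels that occur. A label is missing only if `ι` is empty,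
  -- and then every characteristic polynomial is 1 and has no roots.
  rw [Finset.sum_subset (Finset.subset_univ _), Finset.sum_comm]
  · refine Finset.sum_congr rfl fun c _ => ?_
    by_cases hc : τ c = c <;> simp [hc]
  · intro a _ ha
    refine Finset.sum_eq_zero fun c _ => ?_
    by_cases hι : Nonempty ι
    · rw [if_neg]
      rintro ⟨-, rfl⟩
      exact ha (Finset.mem_image.2 ⟨(c, hι.some), Finset.mem_univ _, rfl⟩)
    · rw [not_nonempty_iff] at hι
      have h1 : (A c).charpoly = 1 := Matrix.det_isEmpty
      rw [h1]; simp [liftedRootSum]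

/-- The lifted trace of an endomorphism of `C → E` that permutes the coordinates up to
endomorphisms of `E`. -/
theorem liftedRootSum_pi [HasEnoughRootsOfUnity F n]
    (θ : rootsOfUnity n F ≃* rootsOfUnity n K) {C E : Type*} [Fintype C] [DecidableEq C]
    [AddCommGroup E] [Module F E] [FiniteDimensional F E]
    (τ : Equiv.Perm C) {k : ℕ} (hk : τ ^ k = 1) (hkn : k ∣ n) (A : C → E →ₗ[F] E)
    (T : (C → E) →ₗ[F] (C → E)) (hT : ∀ f c, T f c = A c (f (τ c))) :
    liftedRootSum θ T.charpoly = ∑ c with τ c = c, liftedRootSum θ (A c).charpoly := by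
  classical
  let b := Module.finBasis F E
  let B : Module.Basis (C × Fin (Module.finrank F E)) F (C → E) :=
    (Pi.basis fun _ : C => b).reindex (Equiv.sigmaEquivProd _ _)
  let A' : C → Matrix _ _ F := fun c => LinearMap.toMatrix b b (A c)
  have hA' : ∀ c i j, A' c i j = b.repr (A c (b j)) i := fun c i j =>
    LinearMap.toMatrix_apply _ _ _ _ _
  have hmat : LinearMap.toMatrix B B T = Matrix.of fun x y =>
      if y.1 = τ x.1 then A' x.1 x.2 y.2 else 0 := by
    ext ⟨c, i⟩ ⟨d, j⟩
    rw [LinearMap.toMatrix_apply, Matrix.of_apply, hA']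
    simp only [B, Module.Basis.reindex_apply,
      Module.Basis.repr_reindex_apply, Equiv.sigmaEquivProd_symm_apply, Pi.basis_repr,
      Pi.basis_apply, hT]
    by_cases h : d = τ c
    · subst h; simp
    · rw [if_neg h, Pi.single_eq_of_ne (Ne.symm h)]; simp
  rw [← LinearMap.charpoly_toMatrix T B, hmat]
  have h := liftedRootSum_monomial θ τ hk hkn A'
  convert h
  convert (LinearMap.charpoly_toMatrix (A _) b).symm

end LiftedTrace

/-! ### Fixed vectors of projective modules are traces -/

section ProjectiveFixedPoints

variable {F H E : Type*} [Field F] [Group H] [AddCommGroup E] [Module F E]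

/-- In the group algebra, an element fixed by a finite subgroup `S` is a trace from the trivial
subgroup to `S`. -/
theorem exists_sum_of_mul_eq_of_mul_eq (S : Subgroup H) [Fintype S] (y : F[H])
    (hy : ∀ x ∈ S, MonoidAlgebra.of F H x * y = y) :
    ∃ y' : F[H], ∑ x : S, MonoidAlgebra.of F H (x : H) * y' = y := by
  classical
  obtain ⟨T, hT, -⟩ := S.exists_isComplement_right 1
  rw [Subgroup.isComplement_iff_existsUnique_inv_mul_mem] at hT
  -- Restrict `y` to a transversal `T`: each `z` lies in `x T` for exactly one `x` in `S`, and
  -- invariance makes the coefficient of `y` at `x⁻¹ z` equal to that at `z`.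
  refine ⟨MonoidAlgebra.ofCoeff (y.coeff.filter (· ∈ T)), ?_⟩
  ext z
  obtain ⟨s₀, hs₀, huniq⟩ := hT z
  have hcoeff : ∀ x : S, (MonoidAlgebra.of F H (x : H) *
      MonoidAlgebra.ofCoeff (y.coeff.filter (· ∈ T))).coeff z =
        if x = s₀ then y.coeff z else 0 := by
    intro x
    have h1 := congrArg (fun w : F[H] => w.coeff z) (hy x x.2)
    simp only [MonoidAlgebra.of_apply, MonoidAlgebra.coeff_single_mul_apply, one_mul] at h1
    rw [MonoidAlgebra.of_apply, MonoidAlgebra.coeff_single_mul_apply, one_mul,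
      MonoidAlgebra.coeff_ofCoeff, Finsupp.filter_apply, h1]
    by_cases hx : x = s₀
    · subst hx
      rw [if_pos rfl, if_pos hs₀]
    · rw [if_neg hx, if_neg]
      exact fun h => hx (huniq x h)
  rw [MonoidAlgebra.coeff_sum, Finsupp.finsetSum_apply, Finset.sum_congr rfl fun x _ => hcoeff x]
  simp

/-- In a projective module, a vector fixed by a finite subgroup `S` is a trace from the trivial
subgroup to `S`. -/
theorem exists_sum_eq_of_projective (σ : Representation F H E)
    (hσ : Module.Projective F[H] σ.asModule) (S : Subgroup H) [Fintype S] (v : E)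
    (hv : ∀ x ∈ S, σ x v = v) : ∃ w, ∑ x : S, σ (x : H) w = v := by
  classical
  -- Split the module off a free one: the coordinates of a fixed vector are fixed elements of the
  -- group algebra, hence traces.
  obtain ⟨s, hs⟩ := hσ.out
  let v' : σ.asModule := σ.asModuleEquiv.symm v
  have hinv : ∀ e, ∀ x ∈ S, MonoidAlgebra.of F H x * s v' e = s v' e := by
    intro e x hx
    have h1 : MonoidAlgebra.of F H x • v' = v' := by
      rw [← Representation.asModuleEquiv_symm_map_rho, hv x hx]
    conv_rhs => rw [← h1, map_smul]
    rfl
  choose y' hy' using fun e => exists_sum_of_mul_eq_of_mul_eq S (s v' e) (hinv e)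
  refine ⟨σ.asModuleEquiv (∑ e ∈ (s v').support, y' e • e), ?_⟩
  have h2 : ∑ x : S, MonoidAlgebra.of F H (x : H) • ∑ e ∈ (s v').support, y' e • e = v' := by
    conv_rhs => rw [← hs v', Finsupp.linearCombination_apply, Finsupp.sum]
    simp only [Finset.smul_sum, ← mul_smul]
    rw [Finset.sum_comm]
    refine Finset.sum_congr rfl fun e _ => ?_
    rw [← Finset.sum_smul, hy']
    rfl
  have h3 := congrArg σ.asModuleEquiv h2
  rw [map_sum] at h3
  simp only [Representation.asModuleEquiv_map_smul, Representation.asAlgebraHom_of] at h3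
  simpa [v'] using h3

end ProjectiveFixedPoints

/-! ### The induced module as equivariant functions -/

section InducedModule

variable {F G E : Type*} [Field F] [Group G] [AddCommGroup E] [Module F E]
  {R : Subgroup G} (σ : Representation F (NBar R) E)

/-- The inflation to `N_G(R)` of a representation of `N̄_G(R)`. -/
abbrev inflation : Representation F (Subgroup.normalizer (R : Set G)) E :=
  σ.comp (QuotientGroup.mk' _)

theorem inflation_of_mem {x : Subgroup.normalizer (R : Set G)} (hx : (x : G) ∈ R) (a : E) :
    inflation σ x a = a := by
  change σ (QuotientGroup.mk x) a = a
  rw [(QuotientGroup.eq_one_iff x).2 (Subgroup.mem_subgroupOf.2 hx)]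
  simp

variable [Finite G]

open Classical in
/-- The identification of the induced module with the module of `N_G(R)`-equivariant functions
`G → E`. -/
def indInfEquiv :
    Representation.IndV (Subgroup.normalizer (R : Set G)).subtype (inflation σ) ≃ₗ[F]
      Representation.coindV (Subgroup.normalizer (R : Set G)).subtype (inflation σ) :=
  LinearEquiv.ofLinearMap (Rep.indToCoind (Rep.of (inflation σ)))
    (Rep.coindToInd (Rep.of (inflation σ)))
    (Rep.coindToInd_indToCoind _) (Rep.indToCoind_coindToInd _)

/-- The value at `h` of the equivariant function attached to an element of the induced module. -/
def indEval (h : G) :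
    Representation.IndV (Subgroup.normalizer (R : Set G)).subtype (inflation σ) →ₗ[F] E :=
  LinearMap.proj h ∘ₗ Submodule.subtype _ ∘ₗ (indInfEquiv σ).toLinearMap

theorem indEval_ext {v w : Representation.IndV (Subgroup.normalizer (R : Set G)).subtype
    (inflation σ)} (h : ∀ g, indEval σ g v = indEval σ g w) : v = w :=
  (indInfEquiv σ).injective (Subtype.ext (funext h))

theorem indEval_mul (x : Subgroup.normalizer (R : Set G)) (h : G)
    (v : Representation.IndV (Subgroup.normalizer (R : Set G)).subtype (inflation σ)) :
    indEval σ (x * h) v = inflation σ x (indEval σ h v) :=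
  (indInfEquiv σ v).2 x h

theorem indEval_mk (h g : G) (a : E) [Decidable (g * h⁻¹ ∈ Subgroup.normalizer (R : Set G))] :
    indEval σ g (Representation.IndV.mk _ (inflation σ) h a) =
      if hg : g * h⁻¹ ∈ Subgroup.normalizer (R : Set G) then inflation σ ⟨g * h⁻¹, hg⟩ a else 0 := by
  classical
  have h1 : indEval σ g (Representation.IndV.mk _ (inflation σ) h a) =
      Rep.indToCoindAux (Rep.of (inflation σ)) h a g := by
    simp [indEval, indInfEquiv]
    rfl
  rw [h1]
  by_cases hg : g * h⁻¹ ∈ Subgroup.normalizer (R : Set G)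
  · rw [dif_pos hg, Rep.indToCoindAux, LinearMap.pi_apply,
      dif_pos (show (QuotientGroup.rightRel _).r g h from
        QuotientGroup.rightRel_apply.2 (by simpa using inv_mem hg))]
  · rw [dif_neg hg]
    apply Rep.indToCoindAux_of_not_rel
    rw [QuotientGroup.rightRel_apply]
    exact fun hh => hg (by simpa using inv_mem hh)

theorem indEval_indInf (g h : G)
    (v : Representation.IndV (Subgroup.normalizer (R : Set G)).subtype (inflation σ)) :
    indEval σ h (indInf R σ g v) = indEval σ (h * g) v := by
  have : indEval σ h ∘ₗ indInf R σ g = indEval σ (h * g) := by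
    apply Representation.IndV.hom_ext
    intro k
    ext a
    classical
    change indEval σ h (Representation.ind _ (inflation σ) g (Representation.IndV.mk _ _ k a)) =
      indEval σ (h * g) (Representation.IndV.mk _ _ k a)
    rw [Representation.ind_mk, indEval_mk, indEval_mk]
    simp only [mul_inv_rev, inv_inv, mul_assoc]
  exact LinearMap.congr_fun this v

end InducedModule

/-! ### Conjugates of `Q` inside `R` -/

section Conjugation

variable {G : Type*} [Group G]

theorem conj_mem_of_conj_smul_le {Q R : Subgroup G} {h : G} (hX : MulAut.conj h • Q ≤ R) {u : G}
    (hu : u ∈ Q) : h * u * h⁻¹ ∈ R :=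
  hX ⟨u, hu, rfl⟩

theorem conj_smul_le_iff {Q R : Subgroup G} {h : G} :
    MulAut.conj h • Q ≤ R ↔ ∀ u ∈ Q, h * u * h⁻¹ ∈ R :=
  ⟨fun hX _ hu => conj_mem_of_conj_smul_le hX hu, by
    rintro H _ ⟨u, hu, rfl⟩
    exact H u hu⟩

/-- This makes the condition ʰQ ≤ R a property of the coset N_G(R)h. Together with its stability
under right translation by N_G(Q), it lets `t` permute the relevant cosets. -/
theorem conj_mul_smul_le_iff {Q R : Subgroup G} {x : G}
    (hx : x ∈ Subgroup.normalizer (R : Set G)) (h : G) :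
    MulAut.conj (x * h) • Q ≤ R ↔ MulAut.conj h • Q ≤ R := by
  simp only [conj_smul_le_iff]
  refine forall₂_congr fun u _ => ?_
  have : x * h * u * (x * h)⁻¹ = x * (h * u * h⁻¹) * x⁻¹ := by group
  rw [this]
  exact (Subgroup.mem_normalizer_iff.1 hx _).symm

theorem conj_smul_le_mul_iff {Q R : Subgroup G} {t : G}
    (ht : t ∈ Subgroup.normalizer (Q : Set G)) (h : G) :
    MulAut.conj (h * t) • Q ≤ R ↔ MulAut.conj h • Q ≤ R := by
  rw [map_mul, mul_smul]
  have : MulAut.conj t • Q = Q := Subgroup.mem_normalizer_iff_map_conj_eq.1 ht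
  rw [this]

end Conjugation

/-! ### Relative traces in the induced module -/

section InducedBrauerQuotient

variable {F G E : Type*} [Field F] [Group G] [Finite G] [AddCommGroup E] [Module F E]
  {R : Subgroup G} (σ : Representation F (NBar R) E) {Q : Subgroup G}

theorem indEval_mul_of_mem {h u : G} (hu : h * u * h⁻¹ ∈ R)
    (v : Representation.IndV (Subgroup.normalizer (R : Set G)).subtype (inflation σ)) :
    indEval σ (h * u) v = indEval σ h v := by
  have h1 := indEval_mul σ ⟨h * u * h⁻¹, Subgroup.le_normalizer hu⟩ h v
  rw [inflation_of_mem σ hu] at h1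
  rw [← h1]
  simp

/-- The generator is supported on N_G(R)h, where right translation by `u` amounts to the action of
huh⁻¹ ∈ R, trivial on an inflated module. This supplies the fixed vectors used below. -/
theorem indInf_mk_of_mem {h u : G} (hu : h * u * h⁻¹ ∈ R) (a : E) :
    indInf R σ u (Representation.IndV.mk _ (inflation σ) h a) =
      Representation.IndV.mk _ (inflation σ) h a := by
  classical
  refine indEval_ext σ fun g => ?_
  have huN : h * u * h⁻¹ ∈ Subgroup.normalizer (R : Set G) := Subgroup.le_normalizer hu
  rw [indEval_indInf, indEval_mk, indEval_mk]
  have e : g * u * h⁻¹ = g * h⁻¹ * (h * u * h⁻¹) := by group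
  by_cases hg : g * h⁻¹ ∈ Subgroup.normalizer (R : Set G)
  · have hg' : g * u * h⁻¹ ∈ Subgroup.normalizer (R : Set G) := by
      rw [e]; exact mul_mem hg huN
    rw [dif_pos hg, dif_pos hg']
    have : (⟨g * u * h⁻¹, hg'⟩ : Subgroup.normalizer (R : Set G)) =
        ⟨g * h⁻¹, hg⟩ * ⟨h * u * h⁻¹, huN⟩ := Subtype.ext e
    rw [this, map_mul, Module.End.mul_apply, inflation_of_mem σ (x := ⟨_, huN⟩) hu]
  · have hg' : ¬ g * u * h⁻¹ ∈ Subgroup.normalizer (R : Set G) := by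
      rw [e, Subgroup.mul_mem_cancel_right _ huN]; exact hg
    rw [dif_neg hg, dif_neg hg']

theorem indEval_relTrace (P Q : Subgroup G) (m : fixed (indInf R σ) P) (g : G) :
    indEval σ g (relTrace (indInf R σ) P Q m : _) =
      ∑ c : Q ⧸ P.subgroupOf Q, indEval σ (g * (c.out : Q)) (m : _) := by
  change indEval σ g ((∑ c : Q ⧸ P.subgroupOf Q, cosetAct (indInf R σ) P Q c) m) = _
  rw [LinearMap.sum_apply, map_sum]
  exact Finset.sum_congr rfl fun c _ => indEval_indInf σ _ _ _

theorem prime_dvd_card_quotient_of_lt {p : ℕ} [Fact p.Prime] (hQ : IsPGroup p Q) {P : Subgroup G}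
    (hP : P < Q) : p ∣ Nat.card (Q ⧸ P.subgroupOf Q) := by
  rw [← Subgroup.index_eq_card]
  obtain ⟨k, hk⟩ := hQ.index (P.subgroupOf Q)
  rw [hk]
  refine dvd_pow_self p ?_
  rintro rfl
  rw [pow_zero, Subgroup.index_eq_one, Subgroup.subgroupOf_eq_top] at hk
  exact hP.not_ge hk

/-- Elements of `∑ tr_P^Q` vanish at the `h` with `ʰQ ≤ R`. -/
theorem indEval_eq_zero_of_mem_traceSum {p : ℕ} [Fact p.Prime] [CharP F p] (hQ : IsPGroup p Q)
    {v : fixed (indInf R σ) Q} (hv : v ∈ traceSum (indInf R σ) Q) {h : G}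
    (hX : MulAut.conj h • Q ≤ R) : indEval σ h (v : _) = 0 := by
  have : traceSum (indInf R σ) Q ≤
      LinearMap.ker (indEval σ h ∘ₗ (fixed (indInf R σ) Q).subtype) := by
    refine iSup₂_le fun P hP => ?_
    rintro _ ⟨m, rfl⟩
    rw [LinearMap.mem_ker, LinearMap.comp_apply, Submodule.subtype_apply, indEval_relTrace,
      Finset.sum_congr rfl fun c _ =>
        indEval_mul_of_mem σ (conj_mem_of_conj_smul_le hX (c.out : Q).2) _,
      Finset.sum_const, Finset.card_univ, ← Nat.card_eq_fintype_card]
    obtain ⟨k, hk⟩ := prime_dvd_card_quotient_of_lt hQ hP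
    rw [hk, ← Nat.cast_smul_eq_nsmul F, Nat.cast_mul, CharP.cast_eq_zero, zero_mul, zero_smul]
  exact this hv

/-- For every fixed vector there is a relative trace from `Q ∩ Rʰ` that agrees with it at `h` and
vanishes off the double coset `N_G(R) h Q`. -/
theorem exists_relTrace_indEval_eq (hσ : Module.Projective F[NBar R] σ.asModule)
    (v : fixed (indInf R σ) Q) (h : G) :
    ∃ m : fixed (indInf R σ) (Q ⊓ R.comap (MulAut.conj h).toMonoidHom),
      indEval σ h (relTrace (indInf R σ) _ Q m : _) = indEval σ h (v : _) ∧
      ∀ g, (∀ u ∈ Q, g * u * h⁻¹ ∉ Subgroup.normalizer (R : Set G)) →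
        indEval σ g (relTrace (indInf R σ) _ Q m : _) = 0 := by
  classical
  have := Fintype.ofFinite G
  set P := Q ⊓ R.comap (MulAut.conj h).toMonoidHom with hP
  -- `S₀` is the set of `u` in `Q` for which `hu` stays in N_G(R)h. It acts on the value at `h`
  -- through `α`, whose kernel is `P`; that value is fixed by the image of `α`.
  let S₀ : Subgroup G := Q ⊓ (Subgroup.normalizer (R : Set G)).comap (MulAut.conj h).toMonoidHom
  let α : S₀ →* NBar R := (QuotientGroup.mk' _).comp
    (((MulAut.conj h).toMonoidHom.comp S₀.subtype).codRestrict
      (Subgroup.normalizer (R : Set G)) fun u => u.2.2)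
  have hα : ∀ u hu, α ⟨u, hu⟩ = QuotientGroup.mk ⟨h * u * h⁻¹, hu.2⟩ := fun _ _ => rfl
  have hαeq : ∀ u hu u' hu', α ⟨u, hu⟩ = α ⟨u', hu'⟩ ↔ h * (u⁻¹ * u') * h⁻¹ ∈ R := by
    intro u hu u' hu'
    rw [hα, hα, QuotientGroup.eq, Subgroup.mem_subgroupOf]
    simp [mul_assoc]
  have : Fintype α.range := Fintype.ofFinite _
  obtain ⟨w, hw⟩ := exists_sum_eq_of_projective σ hσ α.range (indEval σ h (v : _)) (by
    rintro _ ⟨u, rfl⟩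
    have h1 := indEval_mul σ ⟨h * u * h⁻¹, u.2.2⟩ h (v : _)
    have h2 := indEval_indInf σ (u : G) h (v : _)
    rw [mem_fixed.1 v.2 _ u.2.1] at h2
    change inflation σ ⟨h * u * h⁻¹, u.2.2⟩ _ = _
    rw [← h1, h2]
    simp)
  refine ⟨⟨Representation.IndV.mk _ (inflation σ) h w,
    mem_fixed.2 fun u hu => indInf_mk_of_mem σ hu.2 w⟩, ?_, ?_⟩
  · rw [indEval_relTrace, ← hw]
    have hterm : ∀ (c : Q ⧸ P.subgroupOf Q),
        indEval σ (h * (c.out : Q)) (Representation.IndV.mk _ (inflation σ) h w) =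
          if hc : ((c.out : Q) : G) ∈ S₀ then σ (α ⟨_, hc⟩) w else 0 := by
      intro c
      rw [indEval_mk]
      by_cases hc : h * (c.out : Q) * h⁻¹ ∈ Subgroup.normalizer (R : Set G)
      · rw [dif_pos hc, dif_pos (show ((c.out : Q) : G) ∈ S₀ from ⟨(c.out : Q).2, hc⟩)]
        rfl
      · rw [dif_neg hc, dif_neg fun hh => hc hh.2]
    rw [Finset.sum_congr rfl fun c _ => hterm c]
    rw [Finset.sum_dite, Finset.sum_const_zero, add_zero]
    -- Since `P` is the kernel of `α`, the cosets of `P` in `S₀` correspond to the elements of its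
    -- image, so the relative trace at `h` is the trace of `w`.
    refine Finset.sum_bij
      (fun c _ => ⟨α ⟨_, (Finset.mem_filter.1 c.2).2⟩, ⟨_, rfl⟩⟩) (fun _ _ => Finset.mem_univ _)
      ?_ ?_ (fun _ _ => rfl)
    · intro c _ d _ hcd
      have h1 := (hαeq _ _ _ _).1 (Subtype.ext_iff.1 hcd)
      apply Subtype.ext
      rw [← QuotientGroup.out_eq' c.1, ← QuotientGroup.out_eq' d.1, QuotientGroup.eq,
        Subgroup.mem_subgroupOf]
      exact ⟨(_ : Q).2, h1⟩
    · rintro ⟨_, ⟨⟨u, hu⟩, rfl⟩⟩ -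
      obtain ⟨q, hq⟩ := QuotientGroup.mk_out_eq_mul (P.subgroupOf Q) ⟨u, hu.1⟩
      set c : Q ⧸ P.subgroupOf Q := QuotientGroup.mk ⟨u, hu.1⟩ with hc
      have hq' : ((c.out : Q) : G) = u * (q : Q) := by rw [hq]; rfl
      have hqR : h * ((q : Q) : G) * h⁻¹ ∈ R := (Subgroup.mem_subgroupOf.1 q.2).2
      have hcS : ((c.out : Q) : G) ∈ S₀ := by
        rw [hq']
        exact mul_mem hu ⟨(q : Q).2, Subgroup.le_normalizer hqR⟩
      refine ⟨⟨c, Finset.mem_filter.2 ⟨Finset.mem_univ _, hcS⟩⟩, Finset.mem_univ _, ?_⟩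
      apply Subtype.ext
      refine (hαeq _ _ _ _).2 ?_
      rw [hq']
      have e : h * ((u * (q : Q))⁻¹ * u) * h⁻¹ = (h * ((q : Q) : G) * h⁻¹)⁻¹ := by group
      rw [e]
      exact inv_mem hqR
  · intro g hg
    rw [indEval_relTrace]
    refine Finset.sum_eq_zero fun c _ => ?_
    rw [indEval_mk, dif_neg (hg _ (c.out : Q).2)]

/-- A fixed vector that vanishes at the `h` with `ʰQ ≤ R` lies in `∑ tr_P^Q`. -/
theorem mem_traceSum_of_indEval_eq_zero (hσ : Module.Projective F[NBar R] σ.asModule)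
    (v : fixed (indInf R σ) Q)
    (hv : ∀ h, MulAut.conj h • Q ≤ R → indEval σ h (v : _) = 0) :
    v ∈ traceSum (indInf R σ) Q := by
  classical
  have := Fintype.ofFinite G
  -- Induction on the size of the support: subtracting a suitable relative trace removes `h` from it
  -- and adds nothing.
  induction hk : (Finset.univ.filter fun g => indEval σ g (v : _) ≠ 0).card
    using Nat.strong_induction_on generalizing v with
  | _ k ih =>
    by_cases h0 : ∀ g, indEval σ g (v : _) = 0
    · have : v = 0 := Subtype.ext (indEval_ext σ fun g => by rw [h0]; simp)
      rw [this]
      exact zero_mem _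
    · push Not at h0
      obtain ⟨h, hh⟩ := h0
      obtain ⟨m, hm1, hm2⟩ := exists_relTrace_indEval_eq σ hσ v h
      set r := relTrace (indInf R σ) _ Q m with hr
      have hPQ : Q ⊓ R.comap (MulAut.conj h).toMonoidHom < Q := by
        refine lt_of_le_of_ne inf_le_left fun hPQ => hh (hv h ?_)
        rw [conj_smul_le_iff]
        intro u hu
        rw [← hPQ] at hu
        exact hu.2
      have hrmem : r ∈ traceSum (indInf R σ) Q :=
        le_iSup₂_of_le (f := fun (P : Subgroup G) (_ : P < Q) =>
          LinearMap.range (relTrace (indInf R σ) P Q)) _ hPQ le_rfl ⟨m, rfl⟩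
      have hsub : ∀ g, indEval σ g ((v - r : fixed (indInf R σ) Q) : _) =
          indEval σ g (v : _) - indEval σ g (r : _) := fun g => map_sub _ _ _
      have hzero : ∀ g, indEval σ g (v : _) = 0 →
          indEval σ g ((v - r : fixed (indInf R σ) Q) : _) = 0 := by
        intro g hg
        -- On N_G(R)hQ the difference vanishes, by equivariance and `Q`-invariance, because it
        -- vanishes at `h`; elsewhere the trace itself is zero.
        by_cases hgh : ∃ u ∈ Q, g * u * h⁻¹ ∈ Subgroup.normalizer (R : Set G)
        · obtain ⟨u, hu, hN⟩ := hgh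
          have h1 := indEval_indInf σ u g ((v - r : fixed (indInf R σ) Q) : _)
          rw [mem_fixed.1 (v - r).2 _ hu] at h1
          have h2 := indEval_mul σ ⟨_, hN⟩ h ((v - r : fixed (indInf R σ) Q) : _)
          rw [hsub h, hm1, sub_self, map_zero] at h2
          rw [h1, ← h2]
          simp
        · push Not at hgh
          rw [hsub, hg, hm2 g hgh, sub_zero]
      have hmem : v - r ∈ traceSum (indInf R σ) Q := by
        refine ih _ ?_ (v - r) (fun g hg => hzero g (hv g hg)) rfl
        rw [← hk]
        refine Finset.card_lt_card (Finset.ssubset_iff_of_subset ?_ |>.2 ⟨h, ?_, ?_⟩)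
        · intro g
          simp only [Finset.mem_filter, Finset.mem_univ, true_and]
          exact fun hg hg' => hg (hzero g hg')
        · simpa using hh
        · simp only [Finset.mem_filter, Finset.mem_univ, true_and, not_not]
          rw [hsub, hm1, sub_self]
      simpa using add_mem hmem hrmem

end InducedBrauerQuotient

/-! ### The Brauer quotient in coordinates -/

section FixedCosets

variable {F G E : Type*} [Field F] [Group G] [AddCommGroup E] [Module F E]
  {R : Subgroup G} (σ : Representation F (NBar R) E) {Q : Subgroup G}

/-- The cosets `g N_G(R)` with `Q ≤ ᵍR`. -/
abbrev FixedCoset (Q R : Subgroup G) : Type _ :=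
  {c : G ⧸ Subgroup.normalizer (R : Set G) // MulAut.conj c.out⁻¹ • Q ≤ R}

theorem conj_out_smul_le_iff (g : G) :
    MulAut.conj (QuotientGroup.mk g : G ⧸ Subgroup.normalizer (R : Set G)).out⁻¹ • Q ≤ R ↔
      MulAut.conj g⁻¹ • Q ≤ R := by
  obtain ⟨x, hx⟩ := QuotientGroup.mk_out_eq_mul (Subgroup.normalizer (R : Set G)) g
  rw [hx, mul_inv_rev, conj_mul_smul_le_iff (inv_mem x.2)]

/-- The permutation of the cosets `g N_G(R)` with `Q ≤ ᵍR` induced by `t⁻¹`, for `t ∈ N_G(Q)`. -/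
def fixedCosetPerm (Q R : Subgroup G) (t : Subgroup.normalizer (Q : Set G)) :
    Equiv.Perm (FixedCoset Q R) :=
  (MulAction.toPermHom G (G ⧸ Subgroup.normalizer (R : Set G)) (t : G)⁻¹).subtypePerm (by
    intro c
    induction c using QuotientGroup.induction_on with
    | H g =>
      change MulAut.conj (QuotientGroup.mk ((t : G)⁻¹ * g) :
        G ⧸ Subgroup.normalizer (R : Set G)).out⁻¹ • Q ≤ R ↔ _
      rw [conj_out_smul_le_iff, conj_out_smul_le_iff, mul_inv_rev, inv_inv,
        conj_smul_le_mul_iff t.2])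

theorem fixedCosetPerm_apply (t : Subgroup.normalizer (Q : Set G)) (c : FixedCoset Q R) :
    (fixedCosetPerm Q R t c : G ⧸ Subgroup.normalizer (R : Set G)) = (t : G)⁻¹ • c.1 := rfl

theorem smul_eq_iff_out_mem (c : G ⧸ Subgroup.normalizer (R : Set G)) (u : G) :
    u⁻¹ • c = c ↔ c.out⁻¹ * u * c.out ∈ Subgroup.normalizer (R : Set G) := by
  conv_lhs => rw [← QuotientGroup.out_eq' c]
  change (QuotientGroup.mk (u⁻¹ * c.out) : G ⧸ Subgroup.normalizer (R : Set G)) = _ ↔ _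
  rw [QuotientGroup.eq]
  simp [mul_assoc]

/-- This power of `t` lies in `Q`, and `Q` fixes every coset gN_G(R) with g⁻¹Qg ≤ R. Cycle lengths
therefore divide the order of `tQ`. -/
theorem fixedCosetPerm_pow_orderOf (t : Subgroup.normalizer (Q : Set G)) :
    fixedCosetPerm Q R t ^ orderOf (QuotientGroup.mk t : NBar Q) = 1 := by
  set k := orderOf (QuotientGroup.mk t : NBar Q)
  have hk : (t : G) ^ k ∈ Q := by
    have h1 : (QuotientGroup.mk (t ^ k) : NBar Q) = 1 := by
      rw [QuotientGroup.mk_pow]; exact pow_orderOf_eq_one _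
    simpa [Subgroup.mem_subgroupOf] using (QuotientGroup.eq_one_iff _).1 h1
  rw [fixedCosetPerm, Equiv.Perm.subtypePerm_pow]
  ext c
  change (MulAction.toPermHom G (G ⧸ Subgroup.normalizer (R : Set G)) (t : G)⁻¹ ^ k) c.1 = c.1
  rw [← map_pow]
  change ((t : G)⁻¹ ^ k) • c.1 = c.1
  rw [inv_pow, smul_eq_iff_out_mem]
  have := conj_mem_of_conj_smul_le c.2 hk
  rw [inv_inv] at this
  exact Subgroup.le_normalizer this

theorem out_mul_out_mem (c : G ⧸ Subgroup.normalizer (R : Set G)) (t : G) :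
    c.out⁻¹ * t * (t⁻¹ • c).out ∈ Subgroup.normalizer (R : Set G) := by
  have : QuotientGroup.mk (t⁻¹ * c.out) =
      (QuotientGroup.mk (t⁻¹ • c).out : G ⧸ Subgroup.normalizer (R : Set G)) := by
    rw [QuotientGroup.out_eq']
    conv_rhs => rw [← QuotientGroup.out_eq' c]
    rfl
  rw [QuotientGroup.eq] at this
  simpa [mul_assoc] using this

variable [Finite G]

/-- Evaluation of the fixed vectors of the induced module at the fixed cosets. -/
def evalFixedCosets (Q : Subgroup G) : fixed (indInf R σ) Q →ₗ[F] (FixedCoset Q R → E) :=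
  LinearMap.pi fun c => indEval σ c.1.out⁻¹ ∘ₗ (fixed (indInf R σ) Q).subtype

theorem evalFixedCosets_apply (v : fixed (indInf R σ) Q) (c : FixedCoset Q R) :
    evalFixedCosets σ Q v c = indEval σ c.1.out⁻¹ (v : _) := rfl

/-- Prescribed values are attained by adding generators supported on distinct cosets; each is
`Q`-fixed since `Q` is conjugated into `R`. -/
theorem evalFixedCosets_surjective : Function.Surjective (evalFixedCosets σ Q) := by
  classical
  have := Fintype.ofFinite (FixedCoset Q R)
  intro a
  refine ⟨⟨∑ c : FixedCoset Q R, Representation.IndV.mk _ (inflation σ) c.1.out⁻¹ (a c),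
    mem_fixed.2 fun u hu => ?_⟩, ?_⟩
  · rw [map_sum]
    exact Finset.sum_congr rfl fun c _ =>
      indInf_mk_of_mem σ (conj_mem_of_conj_smul_le c.2 hu) _
  · ext d
    change indEval σ d.1.out⁻¹ (∑ c : FixedCoset Q R, _) = a d
    rw [map_sum, Finset.sum_eq_single d]
    · rw [indEval_mk, dif_pos (by rw [mul_inv_cancel]; exact one_mem _)]
      exact inflation_of_mem σ (by simp) _
    · intro c _ hcd
      rw [indEval_mk, dif_neg]
      rw [inv_inv, ← QuotientGroup.eq, QuotientGroup.out_eq', QuotientGroup.out_eq']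
      exact fun h => hcd (Subtype.ext h.symm)
    · simp

theorem ker_evalFixedCosets {p : ℕ} [Fact p.Prime] [CharP F p] (hQ : IsPGroup p Q)
    (hσ : Module.Projective F[NBar R] σ.asModule) :
    LinearMap.ker (evalFixedCosets σ Q) = traceSum (indInf R σ) Q := by
  ext v
  rw [LinearMap.mem_ker]
  constructor
  · intro hv
    refine mem_traceSum_of_indEval_eq_zero σ hσ v fun h hh => ?_
    set c : G ⧸ Subgroup.normalizer (R : Set G) := QuotientGroup.mk h⁻¹ with hc
    have hcX : MulAut.conj c.out⁻¹ • Q ≤ R := by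
      rw [hc, conj_out_smul_le_iff, inv_inv]
      exact hh
    have h1 := congrFun hv ⟨c, hcX⟩
    rw [evalFixedCosets_apply, Pi.zero_apply] at h1
    obtain ⟨x, hx⟩ := QuotientGroup.mk_out_eq_mul (Subgroup.normalizer (R : Set G)) h⁻¹
    have h2 := indEval_mul σ x c.out⁻¹ (v : _)
    rw [h1, map_zero, hc, hx] at h2
    rw [← h2]
    simp
  · intro hv
    ext c
    exact indEval_eq_zero_of_mem_traceSum σ hQ hv c.2

/-- The Brauer quotient of the induced module, as a sum of copies of `E` indexed by the fixed
cosets. -/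
def brauerQuotientEquiv {p : ℕ} [Fact p.Prime] [CharP F p] (hQ : IsPGroup p Q)
    (hσ : Module.Projective F[NBar R] σ.asModule) :
    (fixed (indInf R σ) Q ⧸ traceSum (indInf R σ) Q) ≃ₗ[F] (FixedCoset Q R → E) :=
  (Submodule.quotEquivOfEq _ _ (ker_evalFixedCosets σ hQ hσ).symm).trans
    (LinearMap.quotKerEquivOfSurjective _ (evalFixedCosets_surjective σ))

/-- Evaluation is at inverses of representatives, and (tf)(g⁻¹) = f((t⁻¹g)⁻¹); this is why t⁻¹
permutes the cosets. The factor in N_G(R) compares t⁻¹g with the chosen representative of its coset.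
-/
theorem brauerQuotientEquiv_brauerQuotient {p : ℕ} [Fact p.Prime] [CharP F p] (hQ : IsPGroup p Q)
    (hσ : Module.Projective F[NBar R] σ.asModule) (t : Subgroup.normalizer (Q : Set G))
    (w : fixed (indInf R σ) Q ⧸ traceSum (indInf R σ) Q) (c : FixedCoset Q R) :
    brauerQuotientEquiv σ hQ hσ (brauerQuotient (indInf R σ) Q (QuotientGroup.mk t) w) c =
      inflation σ ⟨_, out_mul_out_mem c.1 t⟩
        (brauerQuotientEquiv σ hQ hσ w (fixedCosetPerm Q R t c)) := by
  obtain ⟨v, rfl⟩ := Submodule.Quotient.mk_surjective _ w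
  change indEval σ c.1.out⁻¹ (indInf R σ t (v : _)) = inflation σ _ (indEval σ _ (v : _))
  rw [indEval_indInf, ← indEval_mul, fixedCosetPerm_apply]
  simp

end FixedCosets

/-! ### From cosets to group elements -/

section CosetSums

/-- The sum over `G` of a function invariant under left translation by `N`. -/
theorem sum_eq_card_mul_sum_out {G K : Type*} [Group G] [Fintype G] [Field K] (N : Subgroup G)
    [Fintype (G ⧸ N)] (φ : G → K) (hφ : ∀ x ∈ N, ∀ g, φ (x * g) = φ g) :
    ∑ g, φ g = Nat.card N * ∑ c : G ⧸ N, φ c.out⁻¹ := by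
  classical
  have := Fintype.ofFinite N
  -- Inverting turns the left cosets of `N` into right cosets, on which `φ` is constant.
  have hbij : Function.Bijective fun y : (G ⧸ N) × N => (y.1.out * y.2 : G)⁻¹ := by
    constructor
    · rintro ⟨c, x⟩ ⟨d, y⟩ h
      have h1 : c.out * (x : G) = d.out * y := inv_injective h
      have hcd : c = d := by
        rw [← QuotientGroup.out_eq' c, ← QuotientGroup.out_eq' d,
          ← QuotientGroup.mk_mul_of_mem c.out x.2, h1, QuotientGroup.mk_mul_of_mem d.out y.2]
      subst hcd
      exact Prod.ext rfl (Subtype.ext (mul_left_cancel h1))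
    · intro g
      obtain ⟨x, hx⟩ := QuotientGroup.mk_out_eq_mul N g⁻¹
      exact ⟨(QuotientGroup.mk g⁻¹, x⁻¹), by simp [hx]⟩
  rw [← hbij.sum_comp, Fintype.sum_prod_type, Finset.mul_sum]
  refine Finset.sum_congr rfl fun c _ => ?_
  have hconst : ∀ x : N, φ (c.out * x : G)⁻¹ = φ c.out⁻¹ := fun x => by
    rw [mul_inv_rev, hφ _ (inv_mem x.2)]
  simp only [hconst]
  rw [Finset.sum_const, Finset.card_univ,
    Nat.card_eq_fintype_card, nsmul_eq_mul]

end CosetSums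

/-! ### Conjugation invariance and orders of `p'`-elements -/

section BrauerCharacter

variable {F K : Type*} [Field F] [Field K] {n : ℕ} [NeZero n]

theorem brauerChar_conj (θ : rootsOfUnity n F ≃* rootsOfUnity n K) {H V : Type*} [Group H]
    [AddCommGroup V] [Module F V] [FiniteDimensional F V] (ρ : Representation F H V) (x h : H) :
    brauerChar θ ρ (x * h * x⁻¹) = brauerChar θ ρ h := by
  let e : V ≃ₗ[F] V := LinearEquiv.ofLinearMap (ρ x) (ρ x⁻¹)
    (by rw [← Module.End.mul_eq_comp, ← map_mul, mul_inv_cancel, map_one]; rfl)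
    (by rw [← Module.End.mul_eq_comp, ← map_mul, inv_mul_cancel, map_one]; rfl)
  have : ρ (x * h * x⁻¹) = e.conj (ρ h) := by
    rw [map_mul, map_mul]; rfl
  unfold brauerChar
  rw [this, LinearEquiv.charpoly_conj]

end BrauerCharacter

/-- The order divides the exponent of `G` and is prime to `p`, so it divides the `p'`-part. This
guarantees a primitive root of unity in `F` for every cycle length. -/
theorem orderOf_dvd_of_isPPrimeElement {p : ℕ} [Fact p.Prime] {G : Type*} [Group G]
    [Finite G] {n : ℕ} (hn : ordCompl[p] (Monoid.exponent G) ∣ n) (Q : Subgroup G)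
    (s : NBar Q) (hs : IsPPrimeElement p s) : orderOf s ∣ n := by
  refine dvd_trans ?_ hn
  have h1 : orderOf s ∣ Monoid.exponent G := by
    obtain ⟨t, rfl⟩ := QuotientGroup.mk_surjective s
    refine (orderOf_map_dvd (QuotientGroup.mk' _) t).trans ?_
    rw [← Subgroup.orderOf_coe]
    exact Monoid.order_dvd_exponent _
  have h2 : (orderOf s).Coprime (p ^ (Monoid.exponent G).factorization p) :=
    (Nat.Coprime.pow_left _ hs).symm
  exact h2.dvd_of_dvd_mul_left (by rwa [Nat.ordProj_mul_ordCompl_eq_self])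

end TrivialSource

end

/-! ### The character formula -/

theorem proposition3p4 {p : ℕ} [Fact p.Prime]
    {F : Type*} [Field F] [CharP F p] {K : Type*} [Field K] [CharZero K]
    {G : Type*} [Group G] [Finite G]
    -- `F` and `K` have enough `p'`-th roots of unity, and these are identified by `θ`
    {n : ℕ} [NeZero n] [HasEnoughRootsOfUnity F n] [HasEnoughRootsOfUnity K n]
    (hn : ordCompl[p] (Monoid.exponent G) ∣ n)
    (θ : rootsOfUnity n F ≃* rootsOfUnity n K)
    -- `(Q, [s]) ∈ 𝓔(G)` and `s = tQ`
    (Q : Subgroup G) (hQ : IsPGroup p Q)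
    (s : TrivialSource.NBar Q) (hs : TrivialSource.IsPPrimeElement p s)
    (t : Subgroup.normalizer (Q : Set G)) (hst : s = QuotientGroup.mk t)
    -- `(R, ψ) ∈ 𝓒(G)` and `E = E_ψ`
    (R : Subgroup G) (hR : IsPGroup p R)
    (ψ : {x : TrivialSource.NBar R // TrivialSource.IsPPrimeElement p x} → K)
    {E : Type*} [AddCommGroup E] [Module F E] [FiniteDimensional F E]
    (σ : Representation F (TrivialSource.NBar R) E)
    (hE : TrivialSource.IsProjectiveIndecomposable p θ ψ σ) :
    TrivialSource.tableEntry θ Q s R σ =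
      ∑ᶠ g : {g : G // MulAut.conj g • Q ≤ R ∧
          MulAut.conj g (t : G) ∈ Subgroup.normalizer (R : Set G)},
        TrivialSource.brauerChar θ σ
            (QuotientGroup.mk ⟨MulAut.conj g.1 (t : G), g.2.2⟩ : TrivialSource.NBar R) /
          (Nat.card (Subgroup.normalizer (R : Set G)) : K) := by

  classical
  have := Fintype.ofFinite G
  have := Fintype.ofFinite (G ⧸ Subgroup.normalizer (R : Set G))
  have := Fintype.ofFinite (TrivialSource.FixedCoset Q R)
  subst hst
  set N := Subgroup.normalizer (R : Set G) with hN
  -- The summand extended by zero to `G`, without the denominator; it is invariant under left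
  -- translation by N_G(R) because Brauer characters are class functions.
  let φ : G → K := fun g =>
    if h : MulAut.conj g • Q ≤ R ∧ MulAut.conj g (t : G) ∈ N then
      TrivialSource.brauerChar θ σ (QuotientGroup.mk ⟨MulAut.conj g (t : G), h.2⟩) else 0
  have hφ : ∀ x ∈ N, ∀ g, φ (x * g) = φ g := by
    intro x hx g
    have e : MulAut.conj (x * g) (t : G) = x * MulAut.conj g (t : G) * x⁻¹ := by
      rw [map_mul]; rfl
    have hiff : MulAut.conj (x * g) (t : G) ∈ N ↔ MulAut.conj g (t : G) ∈ N := by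
      rw [e, Subgroup.mul_mem_cancel_right _ (inv_mem hx), Subgroup.mul_mem_cancel_left _ hx]
    have hX := TrivialSource.conj_mul_smul_le_iff (Q := Q) hx g
    by_cases h : MulAut.conj g • Q ≤ R ∧ MulAut.conj g (t : G) ∈ N
    · have h' : MulAut.conj (x * g) • Q ≤ R ∧ MulAut.conj (x * g) (t : G) ∈ N :=
        ⟨hX.2 h.1, hiff.2 h.2⟩
      simp only [φ]
      rw [dif_pos h, dif_pos h', ← TrivialSource.brauerChar_conj θ σ (QuotientGroup.mk ⟨x, hx⟩)
        (QuotientGroup.mk ⟨MulAut.conj g (t : G), h.2⟩), ← QuotientGroup.mk_mul,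
        ← QuotientGroup.mk_inv, ← QuotientGroup.mk_mul]
      congr 2
      exact Subtype.ext e
    · simp only [φ]
      rw [dif_neg h, dif_neg]
      rintro ⟨h1, h2⟩
      exact h ⟨hX.1 h1, hiff.1 h2⟩
  have hcard : (Nat.card N : K) ≠ 0 := Nat.cast_ne_zero.2 Nat.card_pos.ne'
  have hright : (∑ᶠ g : {g : G // MulAut.conj g • Q ≤ R ∧ MulAut.conj g (t : G) ∈ N},
      TrivialSource.brauerChar θ σ
        (QuotientGroup.mk ⟨MulAut.conj g.1 (t : G), g.2.2⟩ : TrivialSource.NBar R) /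
          (Nat.card N : K)) = ∑ c : G ⧸ N, φ c.out⁻¹ := by
    rw [finsum_eq_sum_of_fintype, ← Finset.sum_div, div_eq_iff hcard, mul_comm,
      ← TrivialSource.sum_eq_card_mul_sum_out N φ hφ]
    rw [← Finset.sum_filter_of_ne (p := fun g =>
      MulAut.conj g • Q ≤ R ∧ MulAut.conj g (t : G) ∈ N)
      (fun g _ hg => by by_contra h; exact hg (dif_neg h)),
      Finset.sum_subtype (p := fun g => MulAut.conj g • Q ≤ R ∧ MulAut.conj g (t : G) ∈ N) _
        (fun g => by rw [Finset.mem_filter, and_iff_right (Finset.mem_univ g)])]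
    refine Finset.sum_congr rfl fun g _ => ?_
    simp only [φ]
    rw [dif_pos g.2]
  rw [hright]
  let e := TrivialSource.brauerQuotientEquiv σ hQ hE.projective
  let T := e.conj (TrivialSource.brauerQuotient (TrivialSource.indInf R σ) Q (QuotientGroup.mk t))
  have hT : ∀ f c, T f c = TrivialSource.inflation σ ⟨_, TrivialSource.out_mul_out_mem c.1 t⟩
      (f (TrivialSource.fixedCosetPerm Q R t c)) := by
    intro f c
    have h := TrivialSource.brauerQuotientEquiv_brauerQuotient σ hQ hE.projective t (e.symm f) c
    rw [show TrivialSource.brauerQuotientEquiv σ hQ hE.projective (e.symm f) = f from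
      e.apply_symm_apply f] at h
    exact h
  have hleft : TrivialSource.tableEntry θ Q (QuotientGroup.mk t) R σ =
      TrivialSource.liftedRootSum θ T.charpoly := by
    rw [LinearEquiv.charpoly_conj]
    rfl
  rw [hleft, TrivialSource.liftedRootSum_pi θ (TrivialSource.fixedCosetPerm Q R t)
    (TrivialSource.fixedCosetPerm_pow_orderOf t)
    (TrivialSource.orderOf_dvd_of_isPPrimeElement hn Q _ hs)
    (fun c => TrivialSource.inflation σ ⟨_, TrivialSource.out_mul_out_mem c.1 t⟩) T hT]
  -- Both sides become sums over the cosets with Q ≤ ᵍR: `φ` vanishes at the others.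
  rw [← Finset.sum_filter_of_ne (s := (Finset.univ : Finset (G ⧸ N)))
      (p := fun c => MulAut.conj c.out⁻¹ • Q ≤ R)
      (fun c _ hc => by by_contra h; exact hc (dif_neg fun h' => h h'.1)),
    Finset.sum_subtype (p := fun c : G ⧸ N => MulAut.conj c.out⁻¹ • Q ≤ R) _ (by simp),
    Finset.sum_filter]
  refine Finset.sum_congr rfl fun c _ => ?_
  -- Being fixed by `t` is exactly the remaining condition in the sum, and on a fixed coset the
  -- comparison factor is the conjugate of `t` itself.
  have hiff : TrivialSource.fixedCosetPerm Q R t c = c ↔ MulAut.conj c.1.out⁻¹ (t : G) ∈ N := by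
    rw [Subtype.ext_iff, TrivialSource.fixedCosetPerm_apply, TrivialSource.smul_eq_iff_out_mem,
      MulAut.conj_apply, inv_inv]
  by_cases hc : TrivialSource.fixedCosetPerm Q R t c = c
  · have hc' := hiff.1 hc
    rw [if_pos hc]
    simp only [φ]
    rw [dif_pos ⟨c.2, hc'⟩]
    have hc1 : (t : G)⁻¹ • c.1 = c.1 := congrArg Subtype.val hc
    have : (⟨_, TrivialSource.out_mul_out_mem c.1 t⟩ : N) = ⟨MulAut.conj c.1.out⁻¹ (t : G), hc'⟩ :=
      Subtype.ext (by simp [hc1])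
    rw [this]
    rfl
  · rw [if_neg hc]
    simp only [φ]
    rw [dif_neg fun h => hc (hiff.2 h.2)]
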